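/- **Formulas.** Formulas of the modal $\mu$-calculus are given by $\varphi ::= p \mid \bar p \mid x \mid \varphi\lor\varphi \mid \varphi\land\varphi \mid \Diamond\varphi \mid \Box\varphi \mid \mu x.\varphi \mid \nu x.\varphi$, with $p$ from a set of propositional variables and $x$ from a set $\mathsf{Var}$ of formal variables. For $\eta\in\{\mu,\nu\}$, $\varphi[\eta x.\varphi]$ denotes the result of replacing every free occurrence of $x$ in $\varphi$ by $\eta x.\varphi$. For a set $\Gamma$ of closed formulas (a sequent) let $\le$ be the subsumption order on formal variables, i.e. the reflexive transitive closure of the relation "$x$ occurs free in a subformula $\eta y.\psi$ of a formula in $\Gamma$". **Annotations.** For each $x\in\mathsf{Var}$ fix an infinite set $\mathsf N_x$ of names for $x$, these sets being pairwise disjoint, and let $\mathsf N=\bigcup_x\mathsf N_x$. For $a\in\mathsf N^*$ write $a\le x$ if $y\le x$ whenever a name from $\mathsf N_y$ occurs in $a$, and let $\sqsubseteq$ be the (scattered, reflexive) subword relation on $\mathsf N^*$. An annotated formula is $\varphi^a$ with $\varphi$ closed and $a\in\mathsf N^*$; an annotated sequent is a set of annotated formulas. **The system Clo.** Its rules (premises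 $\Rightarrow$ conclusion) are: - axiom: $p^\epsilon,\bar p^\epsilon$ (no premise); - $\lor$: $\Gamma,\varphi^a,\psi^a\Rightarrow\Gamma,(\varphi\lor\psi)^a$; - $\land$: $\Gamma,\varphi^a$ and $\Gamma,\psi^a\Rightarrow\Gamma,(\varphi\land\psi)^a$; - weakening: $\Gamma\Rightarrow\Gamma,\varphi^a$; - $\Box$: $\Gamma,\varphi^a\Rightarrow\Diamond\Gamma,(\Box\varphi)^a$, where $\Diamond\Gamma=\{(\Diamond\psi)^b : \psi^b\in\Gamma\}$; - $\eta\in\{\mu,\nu\}$: $\Gamma,\varphi[\eta x.\varphi]^a\Rightarrow\Gamma,(\eta x.\varphi)^a$, where $a\le x$; - exp: $\varphi_1^{a_1},\dots,\varphi_n^{a_n}\Rightarrow\varphi_1^{b_1},\dots,\varphi_n^{b_n}$, where $a_i\sqsubseteq b_i$ for all $i$; - discharge rule $\mathsf{clo}_{\mathsf x}$ with token $\mathsf x\in\mathsf N_x$: $\Gamma,\varphi[\nu x.\varphi]^{a\mathsf x}\Rightarrow\Gamma,(\nu x.\varphi)^a$, where $a\le x$ and $\mathsf x$ does not occur in $\Gamma$;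 above it, leaves labelled by the sequent $\Gamma,(\nu x.\varphi)^{a\mathsf x}$ and the token $\mathsf x$ may be discharged. A Clo derivation of a sequent $\Gamma$ is a (possibly infinite) tree built by these rules whose root is labelled by $\Gamma$ with all annotations empty, in which different discharge rules have different tokens and every leaf is either an axiom or a leaf labelled by a token $\mathsf x$ and discharged by a rule $\mathsf{clo}_{\mathsf x}$ at one of its ancestors. A Clo proof is a finite Clo derivation. **Statement.** Let $p$ be a propositional variable and $x\neq y$ formal variables, and let $$\nu x.\varphi = \nu x.\Diamond\bigl(\bar p\land(\Box x\lor\Diamond\,\nu y.\Box(p\land(\Box x\lor\Diamond y)))\bigr),\qquad \nu y.\psi=\nu y.\Box\bigl(p\land(\Box\,\nu x.\varphi\lor\Diamond y)\bigr),$$ and $\Phi=\{\nu x.\varphi,\ \nu y.\psi\}$. Then there is no Clo proof of $\Phi$; that is, every Clo derivation of $\Phi$ is infinite. -/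

import Mathlib

/-- Formulas of the modal `μ`-calculus over propositional variables `P` and formal variables `V`. -/
inductive MuFormula (P V : Type*) where
  | lit (p : P)
  | nlit (p : P)
  | var (x : V)
  | or (φ ψ : MuFormula P V)
  | and (φ ψ : MuFormula P V)
  | dia (φ : MuFormula P V)
  | box (φ : MuFormula P V)
  | mu (x : V) (φ : MuFormula P V)
  | nu (x : V) (φ : MuFormula P V)

namespace MuFormula

variable {P V : Type*}

/-- The formal variables that occur free in a formula. -/
def freeVars : MuFormula P V → Set V
  | lit _ => ∅
  | nlit _ => ∅
  | var x => {x}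
  | or φ ψ => φ.freeVars ∪ ψ.freeVars
  | and φ ψ => φ.freeVars ∪ ψ.freeVars
  | dia φ => φ.freeVars
  | box φ => φ.freeVars
  | mu x φ => φ.freeVars \ {x}
  | nu x φ => φ.freeVars \ {x}

/-- A formula is closed if every occurrence of a formal variable is bound. -/
def Closed (φ : MuFormula P V) : Prop := φ.freeVars = ∅

/-- The set of subformulas of a formula (including the formula itself). -/
def subformulas : MuFormula P V → Set (MuFormula P V)
  | lit p => {lit p}
  | nlit p => {nlit p}
  | var x => {var x}
  | or φ ψ => insert (or φ ψ) (φ.subformulas ∪ ψ.subformulas)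
  | and φ ψ => insert (and φ ψ) (φ.subformulas ∪ ψ.subformulas)
  | dia φ => insert (dia φ) φ.subformulas
  | box φ => insert (box φ) φ.subformulas
  | mu x φ => insert (mu x φ) φ.subformulas
  | nu x φ => insert (nu x φ) φ.subformulas

/-- `φ.subst x θ`: every free occurrence of `x` in `φ` is replaced by `θ`. It is only used for
closed `θ`, so that no variable can be captured. -/
def subst [DecidableEq V] (x : V) (θ : MuFormula P V) : MuFormula P V → MuFormula P V
  | lit p => lit p
  | nlit p => nlit p
  | var z => if z = x then θ else var z
  | or φ ψ => or (subst x θ φ) (subst x θ ψ)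
  | and φ ψ => and (subst x θ φ) (subst x θ ψ)
  | dia φ => dia (subst x θ φ)
  | box φ => box (subst x θ φ)
  | mu z φ => if z = x then mu z φ else mu z (subst x θ φ)
  | nu z φ => if z = x then nu z φ else nu z (subst x θ φ)

/-- The unfolding `φ[μx.φ]` of `μx.φ`. -/
def unfoldMu [DecidableEq V] (x : V) (φ : MuFormula P V) : MuFormula P V := subst x (mu x φ) φ

/-- The unfolding `φ[νx.φ]` of `νx.φ`. -/
def unfoldNu [DecidableEq V] (x : V) (φ : MuFormula P V) : MuFormula P V := subst x (nu x φ) φ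

/-- The subsumption order on formal variables determined by a set of formulas `Γ`: the reflexive
and transitive closure of "`x` occurs free in a subformula `ηy.ψ` of `Γ`". -/
def Subsumes (Γ : Set (MuFormula P V)) : V → V → Prop :=
  Relation.ReflTransGen fun x y =>
    ∃ γ ∈ Γ, ∃ ψ : MuFormula P V,
      (mu y ψ ∈ γ.subformulas ∧ x ∈ (mu y ψ).freeVars) ∨
      (nu y ψ ∈ γ.subformulas ∧ x ∈ (nu y ψ).freeVars)

end MuFormula

/-- An annotated formula `φ^a`: a formula with a finite word of names. -/
abbrev AnnFormula (P V N : Type*) := MuFormula P V × List N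

/-- An annotated sequent: a set of annotated formulas. -/
abbrev AnnSequent (P V N : Type*) := Set (AnnFormula P V N)

/-- `◇Γ`. -/
def AnnSequent.dia {P V N : Type*} (Γ : AnnSequent P V N) : AnnSequent P V N :=
  (fun f => (MuFormula.dia f.1, f.2)) '' Γ

/-- Instances of the rules of Clo, as labels of the nodes of a derivation. An `asm` label marks a
discharged assumption: a leaf that carries a sequent and a discharge token. -/
inductive CloRule (P V N : Type*) where
  | axLit (p : P)
  | or (Γ : AnnSequent P V N) (φ ψ : MuFormula P V) (a : List N)
  | and (Γ : AnnSequent P V N) (φ ψ : MuFormula P V) (a : List N)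
  | weak (Γ : AnnSequent P V N) (φ : MuFormula P V) (a : List N)
  | box (Γ : AnnSequent P V N) (φ : MuFormula P V) (a : List N)
  | mu (Γ : AnnSequent P V N) (x : V) (φ : MuFormula P V) (a : List N)
  | nu (Γ : AnnSequent P V N) (x : V) (φ : MuFormula P V) (a : List N)
  /-- A list of triples `(φᵢ, aᵢ, bᵢ)`. -/
  | exp (l : List (MuFormula P V × List N × List N))
  /-- The discharge rule with token `n`; its principal formula is `νx.φ^a` where `n` is a name
  for `x`. -/
  | clo (Γ : AnnSequent P V N) (n : N) (φ : MuFormula P V) (a : List N)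
  | asm (S : AnnSequent P V N) (n : N)

namespace CloRule

variable {P V N : Type*}

/-- The conclusion of a rule instance, where `nameVar n` is the formal variable that `n` is a
name for. -/
def conclusion (nameVar : N → V) : CloRule P V N → AnnSequent P V N
  | axLit p => {(MuFormula.lit p, []), (MuFormula.nlit p, [])}
  | or Γ φ ψ a => insert (MuFormula.or φ ψ, a) Γ
  | and Γ φ ψ a => insert (MuFormula.and φ ψ, a) Γ
  | weak Γ φ a => insert (φ, a) Γ
  | box Γ φ a => insert (MuFormula.box φ, a) Γ.dia
  | mu Γ x φ a => insert (MuFormula.mu x φ, a) Γ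
  | nu Γ x φ a => insert (MuFormula.nu x φ, a) Γ
  | exp l => {f | ∃ t ∈ l, f = (t.1, t.2.2)}
  | clo Γ n φ a => insert (MuFormula.nu (nameVar n) φ, a) Γ
  | asm S _ => S

/-- The list of premises of a rule instance. -/
def premises [DecidableEq V] (nameVar : N → V) : CloRule P V N → List (AnnSequent P V N)
  | axLit _ => []
  | or Γ φ ψ a => [insert (φ, a) (insert (ψ, a) Γ)]
  | and Γ φ ψ a => [insert (φ, a) Γ, insert (ψ, a) Γ]
  | weak Γ _ _ => [Γ]
  | box Γ φ a => [insert (φ, a) Γ]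
  | mu Γ x φ a => [insert (MuFormula.unfoldMu x φ, a) Γ]
  | nu Γ x φ a => [insert (MuFormula.unfoldNu x φ, a) Γ]
  | exp l => [{f | ∃ t ∈ l, f = (t.1, t.2.1)}]
  | clo Γ n φ a => [insert (MuFormula.unfoldNu (nameVar n) φ, a ++ [n]) Γ]
  | asm _ _ => []

/-- The side condition of a rule instance, with respect to an order `le` on formal variables. -/
def SideCondition (nameVar : N → V) (le : V → V → Prop) : CloRule P V N → Prop
  | mu _ x _ a => ∀ m ∈ a, le (nameVar m) x
  | nu _ x _ a => ∀ m ∈ a, le (nameVar m) x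
  | exp l => ∀ t ∈ l, t.2.1.Sublist t.2.2
  | clo Γ n _ a => (∀ m ∈ a, le (nameVar m) (nameVar n)) ∧ ∀ f ∈ Γ, n ∉ f.2
  | _ => True

end CloRule

/-- A (possibly infinite) Clo derivation of a sequent `Γ`. Nodes are addressed by finite sequences
of natural numbers, the root being `[]` and the `i`-th child of `u` being `u ++ [i]`;
`label u = none` means that `u` is not a node of the tree. -/
structure CloDerivation {P V N : Type*} [DecidableEq V] (nameVar : N → V)
    (Γ : Set (MuFormula P V)) where
  label : List ℕ → Option (CloRule P V N)
  /-- The root is a node, labelled by `Γ` with empty annotations. -/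
  root : (label []).map (CloRule.conclusion nameVar) = some ((fun φ => (φ, [])) '' Γ)
  /-- The children of a node correspond to the premises of the rule applied there. -/
  child : ∀ (u : List ℕ) (i : ℕ),
    (label (u ++ [i])).map (CloRule.conclusion nameVar) =
      (label u).bind fun r => (r.premises nameVar)[i]?
  side : ∀ (u : List ℕ) (r : CloRule P V N), label u = some r →
    r.SideCondition nameVar (MuFormula.Subsumes Γ)
  closed : ∀ (u : List ℕ) (r : CloRule P V N), label u = some r →
    ∀ f ∈ r.conclusion nameVar, f.1.Closed
  /-- Different discharge rules have different tokens. -/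
  token_unique : ∀ (u v : List ℕ) (n : N) (Δ Δ' : AnnSequent P V N) (φ φ' : MuFormula P V)
    (a a' : List N), label u = some (.clo Δ n φ a) → label v = some (.clo Δ' n φ' a') → u = v
  /-- A leaf with token `n` has an ancestor, its companion, labelled by the discharge rule with
  token `n`, and it carries the sequent that this rule discharges. -/
  discharged : ∀ (u : List ℕ) (S : AnnSequent P V N) (n : N), label u = some (.asm S n) →
    ∃ v, v <+: u ∧ ∃ (Δ : AnnSequent P V N) (φ : MuFormula P V) (a : List N),
      label v = some (.clo Δ n φ a) ∧ S = insert (MuFormula.nu (nameVar n) φ, a ++ [n]) Δ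

/-- A Clo proof is a finite Clo derivation. -/
def CloDerivation.IsProof {P V N : Type*} [DecidableEq V] {nameVar : N → V}
    {Γ : Set (MuFormula P V)} (ρ : CloDerivation nameVar Γ) : Prop :=
  {u : List ℕ | ρ.label u ≠ none}.Finite

namespace MuFormula

variable {P V : Type*}

/-- `νx.φ = νx.◇(¬p ∧ (□x ∨ ◇νy.□(p ∧ (□x ∨ ◇y))))`. -/
def nuXPhi (p : P) (x y : V) : MuFormula P V :=
  nu x (dia (and (nlit p) (or (box (var x))
    (dia (nu y (box (and (lit p) (or (box (var x)) (dia (var y))))))))))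

/-- `νy.ψ = νy.□(p ∧ (□νx.φ ∨ ◇y))`. -/
def nuYPsi (p : P) (x y : V) : MuFormula P V :=
  nu y (box (and (lit p) (or (box (nuXPhi p x y)) (dia (var y)))))

/-- The sequent `Φ = νx.φ, νy.ψ`. -/
def seqPhi (p : P) (x y : V) : Set (MuFormula P V) := {nuXPhi p x y, nuYPsi p x y}

end MuFormula

/-! From the root one can climb a branch that never meets a leaf, so the derivation is infinite. At
each conjunction the climb picks a premise so that, between two modal rules, literals of only one
polarity are kept; hence no axiom is reached.

Discharged leaves are avoided by following names. A leaf discharged by a rule with token `n` and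
side formulas `Γ` contains every name of `T = {n} ∪ names Γ`, and carries `n` on a fixpoint formula.
Tokens are distinct, so a name of `T` once lost on a branch never returns and the rule is dead from
then on. A living token sits on unfolded formulas only, and getting from these back to a fixpoint
formula takes two modal rules.

The first of these has a formula `□bodyY`, with annotation `b`, against a context of formulas
`◇bodyX`. The climb may keep either `b` or the names of the context. If each choice left a rule
alive, there would be a living `νy`-token found only in `b` and a living `νx`-token found only in
the context. But when the later of the two rules was passed, the earlier token sat on an unfolded
formula, hence on a side formula, so it belongs to the later rule's `T`: a contradiction. Thus one
choice kills all rules (`FixpointInv.box`), and the climb starts afresh after the second modal rule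
(`BodyInvs.box`). -/

section Invariants

open MuFormula

variable {P V N : Type*}

/-! ### Names and tokens along a branch -/

/-- The names that occur in an annotated sequent. -/
def AnnSequent.names (S : AnnSequent P V N) : Set N := {n | ∃ f ∈ S, n ∈ f.2}

/-- Going from the conclusion of a rule to a premise, the only name that can appear is the token
of a discharge rule. -/
theorem CloRule.mem_names_of_premise [DecidableEq V] {nameVar : N → V} {le : V → V → Prop}
    {r : CloRule P V N} (hr : r.SideCondition nameVar le) {i : ℕ} {S : AnnSequent P V N}
    (hS : (r.premises nameVar)[i]? = some S) {m : N} (hm : m ∈ S.names) :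
    m ∈ (r.conclusion nameVar).names ∨ ∃ Γ φ a, r = .clo Γ m φ a := by
  obtain ⟨f, hf, hmf⟩ := hm
  have hmem := List.mem_of_getElem? hS
  cases r with
  | axLit p => simp [premises] at hmem
  | asm S n => simp [premises] at hmem
  | or Γ φ ψ a =>
    simp only [premises, List.mem_singleton] at hmem
    subst hmem
    rcases hf with rfl | rfl | hf
    · exact .inl ⟨_, Set.mem_insert _ _, hmf⟩
    · exact .inl ⟨_, Set.mem_insert _ _, hmf⟩
    · exact .inl ⟨_, Set.mem_insert_of_mem _ hf, hmf⟩
  | and Γ φ ψ a =>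
    simp only [premises, List.mem_cons, List.not_mem_nil, or_false] at hmem
    rcases hmem with rfl | rfl <;> rcases hf with rfl | hf
    · exact .inl ⟨_, Set.mem_insert _ _, hmf⟩
    · exact .inl ⟨_, Set.mem_insert_of_mem _ hf, hmf⟩
    · exact .inl ⟨_, Set.mem_insert _ _, hmf⟩
    · exact .inl ⟨_, Set.mem_insert_of_mem _ hf, hmf⟩
  | weak Γ φ a =>
    simp only [premises, List.mem_singleton] at hmem
    subst hmem
    exact .inl ⟨_, Set.mem_insert_of_mem _ hf, hmf⟩
  | box Γ φ a =>
    simp only [premises, List.mem_singleton] at hmem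
    subst hmem
    rcases hf with rfl | hf
    · exact .inl ⟨_, Set.mem_insert _ _, hmf⟩
    · exact .inl ⟨_, Set.mem_insert_of_mem _ (Set.mem_image_of_mem _ hf), hmf⟩
  | mu Γ z φ a =>
    simp only [premises, List.mem_singleton] at hmem
    subst hmem
    rcases hf with rfl | hf
    · exact .inl ⟨_, Set.mem_insert _ _, hmf⟩
    · exact .inl ⟨_, Set.mem_insert_of_mem _ hf, hmf⟩
  | nu Γ z φ a =>
    simp only [premises, List.mem_singleton] at hmem
    subst hmem
    rcases hf with rfl | hf
    · exact .inl ⟨_, Set.mem_insert _ _, hmf⟩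
    · exact .inl ⟨_, Set.mem_insert_of_mem _ hf, hmf⟩
  | exp l =>
    simp only [premises, List.mem_singleton] at hmem
    subst hmem
    obtain ⟨t, ht, rfl⟩ := hf
    exact .inl ⟨_, ⟨t, ht, rfl⟩, (hr t ht).subset hmf⟩
  | clo Γ n φ a =>
    simp only [premises, List.mem_singleton] at hmem
    subst hmem
    rcases hf with rfl | hf
    · rcases List.mem_append.1 hmf with h | h
      · exact .inl ⟨_, Set.mem_insert _ _, h⟩
      · obtain rfl := List.mem_singleton.1 h
        exact .inr ⟨_, _, _, rfl⟩
    · exact .inl ⟨_, Set.mem_insert_of_mem _ hf, hmf⟩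

namespace CloDerivation

variable [DecidableEq V] {nameVar : N → V} {Φ : Set (MuFormula P V)}

/-- A discharge rule with token `n` was applied strictly below `u`, and `T` consists of `n` and
the names of the side formulas of that rule. -/
def Opened (ρ : CloDerivation nameVar Φ) (u : List ℕ) (n : N) (T : Set N) : Prop :=
  ∃ v Γ φ a, v <+: u ∧ v ≠ u ∧ ρ.label v = some (.clo Γ n φ a) ∧ T = insert n Γ.names

theorem opened_concat (ρ : CloDerivation nameVar Φ) {u : List ℕ} {i : ℕ} {n : N} {T : Set N} :
    ρ.Opened (u ++ [i]) n T ↔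
      ρ.Opened u n T ∨ ∃ Γ φ a, ρ.label u = some (.clo Γ n φ a) ∧ T = insert n Γ.names := by
  constructor
  · rintro ⟨v, Γ, φ, a, hv, hne, hl, hT⟩
    rcases List.prefix_concat_iff.1 hv with rfl | hv
    · exact absurd rfl hne
    · by_cases h : v = u
      · exact .inr ⟨Γ, φ, a, h ▸ hl, hT⟩
      · exact .inl ⟨v, Γ, φ, a, hv, h, hl, hT⟩
  · rintro (⟨v, Γ, φ, a, hv, hne, hl, hT⟩ | ⟨Γ, φ, a, hl, hT⟩)
    · refine ⟨v, Γ, φ, a, hv.trans (List.prefix_append _ _), ?_, hl, hT⟩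
      rintro rfl
      simpa using hv.length_le
    · exact ⟨u, Γ, φ, a, List.prefix_append _ _, by simp, hl, hT⟩

theorem exists_child (ρ : CloDerivation nameVar Φ) {u : List ℕ} {r : CloRule P V N}
    (hu : ρ.label u = some r) {i : ℕ} {S : AnnSequent P V N}
    (hS : (r.premises nameVar)[i]? = some S) :
    ∃ r', ρ.label (u ++ [i]) = some r' ∧ r'.conclusion nameVar = S := by
  have h := ρ.child u i
  rw [hu, Option.bind_some, hS] at h
  simpa using h

/-- Every name that occurs at a node was introduced by a discharge rule strictly below it. -/
theorem opened_of_mem_names (ρ : CloDerivation nameVar Φ) {u : List ℕ} {r : CloRule P V N}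
    (hu : ρ.label u = some r) {m : N} (hm : m ∈ (r.conclusion nameVar).names) :
    ∃ T, ρ.Opened u m T := by
  induction u using List.reverseRecOn generalizing r with
  | nil =>
    have h := ρ.root
    rw [hu, Option.map_some, Option.some_inj] at h
    rw [h] at hm
    obtain ⟨f, ⟨φ, -, rfl⟩, hf⟩ := hm
    simp at hf
  | append_singleton u i ih =>
    have h := ρ.child u i
    rw [hu, Option.map_some] at h
    obtain ⟨s, hs, hi⟩ := Option.bind_eq_some_iff.1 h.symm
    rcases CloRule.mem_names_of_premise (ρ.side u s hs) hi hm with h | ⟨Γ, φ, a, rfl⟩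
    · obtain ⟨T, hT⟩ := ih hs h
      exact ⟨T, ρ.opened_concat.2 (.inl hT)⟩
    · exact ⟨_, ρ.opened_concat.2 (.inr ⟨Γ, φ, a, hs, rfl⟩)⟩

/-- All of `T` apart from `n` already occurs in the conclusion of the discharge rule, so it was
introduced still closer to the root. This is what shows that a new token lies in no older `T`. -/
theorem opened_of_mem (ρ : CloDerivation nameVar Φ) {u : List ℕ} {n : N} {T : Set N}
    (h : ρ.Opened u n T) {m : N} (hm : m ∈ T) : ∃ T', ρ.Opened u m T' := by
  obtain ⟨v, Γ, φ, a, hv, hne, hl, rfl⟩ := h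
  rcases hm with rfl | ⟨f, hf, hmf⟩
  · exact ⟨_, v, Γ, φ, a, hv, hne, hl, rfl⟩
  · obtain ⟨T', w, Γ', φ', a', hw, hne', hl', hT'⟩ := ρ.opened_of_mem_names hl
      (m := m) ⟨f, Set.mem_insert_of_mem _ hf, hmf⟩
    refine ⟨T', w, Γ', φ', a', hw.trans hv, ?_, hl', hT'⟩
    rintro rfl
    exact hne' (hw.eq_of_length_le hv.length_le)

/-- The token of a discharge rule was not introduced below that rule. -/
theorem not_opened_of_clo (ρ : CloDerivation nameVar Φ) {u : List ℕ} {n : N}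
    {Γ : AnnSequent P V N} {φ : MuFormula P V} {a : List N}
    (hu : ρ.label u = some (.clo Γ n φ a)) (T : Set N) : ¬ ρ.Opened u n T := by
  rintro ⟨v, Γ', φ', a', -, hne, hl, -⟩
  exact hne (ρ.token_unique _ _ _ _ _ _ _ _ _ hl hu)

end CloDerivation

/-! ### The formulas on the branch and the two invariants -/

/-- `□νx.φ ∨ ◇νy.ψ`. -/
def stepOr (p : P) (x y : V) : MuFormula P V := .or (.box (nuXPhi p x y)) (.dia (nuYPsi p x y))

/-- `¬p ∧ (□νx.φ ∨ ◇νy.ψ)`, so that `νx.φ` unfolds to `◇` of this formula. -/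
def bodyX (p : P) (x y : V) : MuFormula P V := .and (.nlit p) (stepOr p x y)

/-- `p ∧ (□νx.φ ∨ ◇νy.ψ)`, so that `νy.ψ` unfolds to `□` of this formula. -/
def bodyY (p : P) (x y : V) : MuFormula P V := .and (.lit p) (stepOr p x y)

theorem unfoldNu_of_nu_eq_nuXPhi [DecidableEq V] {p : P} {x y z : V} (hxy : x ≠ y)
    {φ : MuFormula P V} (h : MuFormula.nu z φ = nuXPhi p x y) :
    z = x ∧ unfoldNu z φ = .dia (bodyX p x y) := by
  obtain ⟨rfl, rfl⟩ := MuFormula.nu.inj h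
  simp [unfoldNu, MuFormula.subst, bodyX, stepOr, nuXPhi, nuYPsi, hxy.symm]

theorem unfoldNu_of_nu_eq_nuYPsi [DecidableEq V] {p : P} {x y z : V} (hxy : x ≠ y)
    {φ : MuFormula P V} (h : MuFormula.nu z φ = nuYPsi p x y) :
    z = y ∧ unfoldNu z φ = .box (bodyY p x y) := by
  obtain ⟨rfl, rfl⟩ := MuFormula.nu.inj h
  simp [unfoldNu, MuFormula.subst, bodyY, stepOr, nuXPhi, nuYPsi, hxy]

/-- The invariant for sequents over `νx.φ`, `νy.ψ` and their unfoldings, where `H n T` says that a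
discharge rule with token `n` has been passed, `T` being `n` and the names of its side formulas.
Such a rule is either *dead*, because a name from `T` has been lost, or its token sits on unfolded
formulas only. If two living rules belong to different fixpoints, the token of one of them occurs
in the side formulas of the other. -/
structure FixpointInv (nameVar : N → V) (p : P) (x y : V) (H : N → Set N → Prop)
    (S : AnnSequent P V N) : Prop where
  formula : ∀ f ∈ S, f.1 = nuXPhi p x y ∨ f.1 = nuYPsi p x y ∨ f.1 = .dia (bodyX p x y) ∨
    f.1 = .box (bodyY p x y)
  unfolded : ∀ n T, H n T → T ⊆ S.names →
    (nameVar n = x ∧ ∀ f ∈ S, n ∈ f.2 → f.1 = .dia (bodyX p x y)) ∨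
    (nameVar n = y ∧ ∀ f ∈ S, n ∈ f.2 → f.1 = .box (bodyY p x y))
  linked : ∀ n T n' T', H n T → H n' T' → T ⊆ S.names → T' ⊆ S.names →
    nameVar n = x → nameVar n' = y → n ∈ T' ∨ n' ∈ T

/-- The invariant for sequents over the bodies and their subformulas: the formulas in `F` are going
to be reduced to literals, and all other formulas carry only names from a set in which no
discharge rule survives. -/
def BodyInv (p : P) (x y : V) (F : Set (MuFormula P V)) (H : N → Set N → Prop)
    (S : AnnSequent P V N) : Prop :=
  ∃ K : Set N, (∀ n T, H n T → ¬ T ⊆ K) ∧ ∀ f ∈ S, f.1 ∈ F ∨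
    (f.1 = bodyX p x y ∨ f.1 = bodyY p x y ∨ f.1 = stepOr p x y ∨ f.1 = .box (nuXPhi p x y) ∨
      f.1 = .dia (nuYPsi p x y)) ∧ ∀ n ∈ f.2, n ∈ K

/-- The two ways to falsify the literals: keep the traces through `νx.φ`, or the one through
`νy.ψ`. -/
def BodyInvs (p : P) (x y : V) (H : N → Set N → Prop) (S : AnnSequent P V N) : Prop :=
  BodyInv p x y {bodyY p x y, .lit p} H S ∨ BodyInv p x y {bodyX p x y, .nlit p} H S

variable {nameVar : N → V} {p : P} {x y : V} {H H' : N → Set N → Prop}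
  {S S' : AnnSequent P V N}

/-! ### Preservation of the fixpoint invariant -/

/-- The invariant passes to sequents in which annotations have shrunk and fixpoint formulas may
have been unfolded. -/
theorem FixpointInv.of_le (h : FixpointInv nameVar p x y H S)
    (hf : ∀ f ∈ S', f.1 = nuXPhi p x y ∨ f.1 = nuYPsi p x y ∨ f.1 = .dia (bodyX p x y) ∨
      f.1 = .box (bodyY p x y))
    (hS : ∀ f ∈ S', ∃ g ∈ S, f.2 ⊆ g.2 ∧ (f.1 = g.1 ∨ ∃ z φ, g.1 = .nu z φ)) :
    FixpointInv nameVar p x y H S' := by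
  have hn : S'.names ⊆ S.names := by
    rintro n ⟨f, hf, hn⟩
    obtain ⟨g, hg, hfg, -⟩ := hS f hf
    exact ⟨g, hg, hfg hn⟩
  refine ⟨hf, fun n T hT hTS => ?_, fun n T n' T' hT hT' hTS hTS' =>
    h.linked n T n' T' hT hT' (hTS.trans hn) (hTS'.trans hn)⟩
  refine (h.unfolded n T hT (hTS.trans hn)).imp (fun h => ⟨h.1, ?_⟩) (fun h => ⟨h.1, ?_⟩)
  all_goals
    intro f hf hnf
    obtain ⟨g, hg, hfg, e⟩ := hS f hf
    have hg := h.2 g hg (hfg hnf)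
    rcases e with e | ⟨z, φ, e⟩
    · rw [e, hg]
    -- A formula carrying a living token starts with `◇` or `□`, so it is not the one being
    -- unfolded.
    · simp [hg] at e

/-- Passing a discharge rule for `νx.φ`. -/
theorem FixpointInv.clo_nuXPhi (hxy : x ≠ y) {Γ : AnnSequent P V N} {a : List N} {n : N}
    (h : FixpointInv nameVar p x y H (insert (nuXPhi p x y, a) Γ)) (hn : nameVar n = x)
    (hnew : ∀ m T, H m T → n ∉ T) (hself : ∀ m T, H m T → m ∈ T)
    (hna : n ∉ AnnSequent.names (insert (nuXPhi p x y, a) Γ))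
    (hH : ∀ m T, H' m T ↔ H m T ∨ (m = n ∧ T = insert n Γ.names)) :
    FixpointInv nameVar p x y H' (insert (.dia (bodyX p x y), a ++ [n]) Γ) := by
  -- The only new name `n` is in no older `T`, so an older rule alive in the premise was alive in
  -- the conclusion.
  have old : ∀ m T, H m T → T ⊆ AnnSequent.names (insert (.dia (bodyX p x y), a ++ [n]) Γ) →
      T ⊆ AnnSequent.names (insert (nuXPhi p x y, a) Γ) := by
    intro m T hT hTS k hk
    obtain ⟨f, rfl | hf, hkf⟩ := hTS hk
    · rcases List.mem_append.1 hkf with h | h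
      · exact ⟨_, Set.mem_insert _ _, h⟩
      · exact absurd (List.mem_singleton.1 h ▸ hk) (hnew m T hT)
    · exact ⟨f, Set.mem_insert_of_mem _ hf, hkf⟩
  refine ⟨?_, ?_, ?_⟩
  · rintro f (rfl | hf)
    · simp
    · exact h.formula f (Set.mem_insert_of_mem _ hf)
  · intro m T hT hTS
    rcases (hH m T).1 hT with hT | ⟨rfl, rfl⟩
    · have hmn : m ≠ n := fun e => hnew m T hT (e ▸ hself m T hT)
      refine (h.unfolded m T hT (old m T hT hTS)).imp (fun h => ⟨h.1, ?_⟩) (fun h => ⟨h.1, ?_⟩)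
      all_goals
        rintro f (rfl | hf) hmf
        · have := h.2 _ (Set.mem_insert _ _)
            ((List.mem_append.1 hmf).resolve_right (by simpa using hmn))
          simp [nuXPhi] at this
        · exact h.2 f (Set.mem_insert_of_mem _ hf) hmf
    · refine .inl ⟨hn, ?_⟩
      rintro f (rfl | hf) hmf
      · rfl
      · exact absurd ⟨f, Set.mem_insert_of_mem _ hf, hmf⟩ hna
  · intro m T m' T' hT hT' hTS hTS' hm hm'
    have hm'n : m' ≠ n := by
      rintro rfl
      exact hxy (hn.symm.trans hm')
    have hT' := ((hH m' T').1 hT').resolve_right fun e => hm'n e.1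
    rcases (hH m T).1 hT with hT | ⟨rfl, rfl⟩
    · exact h.linked m T m' T' hT hT' (old m T hT hTS) (old m' T' hT' hTS') hm hm'
    -- The living `νy`-token `m'` cannot sit on the principal formula, which is still folded; so it
    -- is on a side formula and belongs to the new rule's set.
    · obtain ⟨f, rfl | hf, hf'⟩ := old m' T' hT' hTS' (hself m' T' hT')
      · rcases h.unfolded m' T' hT' (old m' T' hT' hTS') with h | h
        · exact absurd (h.1.symm.trans hm') hxy
        · have := h.2 _ (Set.mem_insert _ _) hf'
          simp [nuXPhi] at this
      · exact .inr (Set.mem_insert_of_mem _ ⟨f, hf, hf'⟩)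

/-- Passing a discharge rule for `νy.ψ`. -/
theorem FixpointInv.clo_nuYPsi (hxy : x ≠ y) {Γ : AnnSequent P V N} {a : List N} {n : N}
    (h : FixpointInv nameVar p x y H (insert (nuYPsi p x y, a) Γ)) (hn : nameVar n = y)
    (hnew : ∀ m T, H m T → n ∉ T) (hself : ∀ m T, H m T → m ∈ T)
    (hna : n ∉ AnnSequent.names (insert (nuYPsi p x y, a) Γ))
    (hH : ∀ m T, H' m T ↔ H m T ∨ (m = n ∧ T = insert n Γ.names)) :
    FixpointInv nameVar p x y H' (insert (.box (bodyY p x y), a ++ [n]) Γ) := by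
  have old : ∀ m T, H m T → T ⊆ AnnSequent.names (insert (.box (bodyY p x y), a ++ [n]) Γ) →
      T ⊆ AnnSequent.names (insert (nuYPsi p x y, a) Γ) := by
    intro m T hT hTS k hk
    obtain ⟨f, rfl | hf, hkf⟩ := hTS hk
    · rcases List.mem_append.1 hkf with h | h
      · exact ⟨_, Set.mem_insert _ _, h⟩
      · exact absurd (List.mem_singleton.1 h ▸ hk) (hnew m T hT)
    · exact ⟨f, Set.mem_insert_of_mem _ hf, hkf⟩
  refine ⟨?_, ?_, ?_⟩
  · rintro f (rfl | hf)
    · simp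
    · exact h.formula f (Set.mem_insert_of_mem _ hf)
  · intro m T hT hTS
    rcases (hH m T).1 hT with hT | ⟨rfl, rfl⟩
    · have hmn : m ≠ n := fun e => hnew m T hT (e ▸ hself m T hT)
      refine (h.unfolded m T hT (old m T hT hTS)).imp (fun h => ⟨h.1, ?_⟩) (fun h => ⟨h.1, ?_⟩)
      all_goals
        rintro f (rfl | hf) hmf
        · have := h.2 _ (Set.mem_insert _ _)
            ((List.mem_append.1 hmf).resolve_right (by simpa using hmn))
          simp [nuYPsi] at this
        · exact h.2 f (Set.mem_insert_of_mem _ hf) hmf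
    · refine .inr ⟨hn, ?_⟩
      rintro f (rfl | hf) hmf
      · rfl
      · exact absurd ⟨f, Set.mem_insert_of_mem _ hf, hmf⟩ hna
  · intro m T m' T' hT hT' hTS hTS' hm hm'
    have hmn : m ≠ n := by
      rintro rfl
      exact hxy (hm.symm.trans hn)
    have hT := ((hH m T).1 hT).resolve_right fun e => hmn e.1
    rcases (hH m' T').1 hT' with hT' | ⟨rfl, rfl⟩
    · exact h.linked m T m' T' hT hT' (old m T hT hTS) (old m' T' hT' hTS') hm hm'
    · obtain ⟨f, rfl | hf, hf'⟩ := old m T hT hTS (hself m T hT)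
      · rcases h.unfolded m T hT (old m T hT hTS) with h | h
        · have := h.2 _ (Set.mem_insert _ _) hf'
          simp [nuYPsi] at this
        · exact absurd (hm.symm.trans h.1) hxy
      · exact .inl (Set.mem_insert_of_mem _ ⟨f, hf, hf'⟩)

/-- At a modal rule one of the two ways to falsify the literals kills all discharge rules. -/
theorem FixpointInv.box {Γ : AnnSequent P V N} {φ : MuFormula P V} {b : List N}
    (hself : ∀ m T, H m T → m ∈ T)
    (h : FixpointInv nameVar p x y H (insert (.box φ, b) Γ.dia)) :
    BodyInvs p x y H (insert (φ, b) Γ) := by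
  have hφ : φ = bodyY p x y := by
    simpa [nuXPhi, nuYPsi] using h.formula _ (Set.mem_insert _ _)
  subst hφ
  have hΓ : ∀ f ∈ Γ, f.1 = bodyX p x y := fun f hf => by
    simpa [nuXPhi, nuYPsi] using
      h.formula _ (Set.mem_insert_of_mem _ (Set.mem_image_of_mem _ hf))
  -- If `b` keeps no rule alive, the trace through `νy.ψ` is kept and the context is reduced to
  -- `¬p`. Otherwise the context is kept, and the rule surviving in `b` serves to show that none
  -- survives there.
  by_cases hb : ∀ n T, H n T → ¬ T ⊆ {m | m ∈ b}
  · refine .inr ⟨_, hb, ?_⟩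
    rintro f (rfl | hf)
    · exact .inr ⟨by simp, fun n hn => hn⟩
    · exact .inl (.inl (hΓ f hf))
  · push Not at hb
    obtain ⟨n', T', hT', hT'b⟩ := hb
    refine .inl ⟨Γ.names, fun n T hT hTΓ => ?_, ?_⟩
    · have hTS : T ⊆ AnnSequent.names (insert (.box (bodyY p x y), b) Γ.dia) := by
        intro k hk
        obtain ⟨f, hf, hkf⟩ := hTΓ hk
        exact ⟨_, Set.mem_insert_of_mem _ (Set.mem_image_of_mem _ hf), hkf⟩
      have hTS' : T' ⊆ AnnSequent.names (insert (.box (bodyY p x y), b) Γ.dia) :=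
        fun k hk => ⟨_, Set.mem_insert _ _, hT'b hk⟩
      have hX : nameVar n = x ∧ n ∉ b := by
        rcases h.unfolded n T hT hTS with h | h
        · refine ⟨h.1, fun hn => ?_⟩
          have := h.2 _ (Set.mem_insert _ _) hn
          simp at this
        · obtain ⟨f, hf, hnf⟩ := hTΓ (hself n T hT)
          have := h.2 _ (Set.mem_insert_of_mem _ (Set.mem_image_of_mem _ hf)) hnf
          simp at this
      have hY : nameVar n' = y ∧ n' ∉ Γ.names := by
        rcases h.unfolded n' T' hT' hTS' with h | h
        · have := h.2 _ (Set.mem_insert _ _) (hT'b (hself n' T' hT'))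
          simp at this
        · refine ⟨h.1, fun ⟨f, hf, hnf⟩ => ?_⟩
          have := h.2 _ (Set.mem_insert_of_mem _ (Set.mem_image_of_mem _ hf)) hnf
          simp at this
      rcases h.linked n T n' T' hT hT' hTS hTS' hX.1 hY.1 with h | h
      · exact hX.2 (hT'b h)
      · exact hY.2 (hTΓ h)
    · rintro f (rfl | hf)
      · simp
      · exact .inr ⟨.inl (hΓ f hf), fun n hn => ⟨f, hf, hn⟩⟩

/-! ### Preservation of the body invariants -/

theorem BodyInv.of_le {F : Set (MuFormula P V)} (h : BodyInv p x y F H S)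
    (hS : ∀ f ∈ S', ∃ g ∈ S, f.2 ⊆ g.2 ∧ f.1 = g.1) : BodyInv p x y F H S' := by
  obtain ⟨K, hK, hf⟩ := h
  refine ⟨K, hK, fun f hfS => ?_⟩
  obtain ⟨g, hg, hfg, e⟩ := hS f hfS
  rw [e]
  exact (hf g hg).imp_right fun h => ⟨h.1, fun n hn => h.2 n (hfg hn)⟩

theorem BodyInvs.of_le (h : BodyInvs p x y H S)
    (hS : ∀ f ∈ S', ∃ g ∈ S, f.2 ⊆ g.2 ∧ f.1 = g.1) : BodyInvs p x y H S' :=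
  h.imp (·.of_le hS) (·.of_le hS)

theorem BodyInvs.formula (h : BodyInvs p x y H S) {f : AnnFormula P V N} (hf : f ∈ S) :
    f.1 = .lit p ∨ f.1 = .nlit p ∨ f.1 = bodyX p x y ∨ f.1 = bodyY p x y ∨
      f.1 = stepOr p x y ∨ f.1 = .box (nuXPhi p x y) ∨ f.1 = .dia (nuYPsi p x y) := by
  rcases h with ⟨K, -, h⟩ | ⟨K, -, h⟩ <;> rcases h f hf with (h | h) | ⟨h, -⟩ <;> tauto

theorem BodyInvs.or {Γ : AnnSequent P V N} {φ ψ : MuFormula P V} {a : List N}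
    (h : BodyInvs p x y H (insert (.or φ ψ, a) Γ)) :
    BodyInvs p x y H (insert (φ, a) (insert (ψ, a) Γ)) := by
  have e := h.formula (Set.mem_insert _ _)
  simp only [bodyX, bodyY, stepOr, reduceCtorEq, MuFormula.or.injEq, false_or, or_false] at e
  obtain ⟨rfl, rfl⟩ := e
  refine h.imp ?_ ?_
  all_goals
    rintro ⟨K, hK, h⟩
    have hD := (h _ (Set.mem_insert _ _)).resolve_left (by simp [bodyX, bodyY])
    refine ⟨K, hK, ?_⟩
    rintro f (rfl | rfl | hf)
    · exact .inr ⟨by simp, hD.2⟩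
    · exact .inr ⟨by simp, hD.2⟩
    · exact h f (Set.mem_insert_of_mem _ hf)

/-- A body in `F` is followed to its literal, the other body to `stepOr`. The literal's annotation
is irrelevant, while `stepOr` inherits one contained in `K`. -/
theorem BodyInvs.and {Γ : AnnSequent P V N} {φ ψ : MuFormula P V} {a : List N}
    (h : BodyInvs p x y H (insert (.and φ ψ, a) Γ)) :
    BodyInvs p x y H (insert (φ, a) Γ) ∨ BodyInvs p x y H (insert (ψ, a) Γ) := by
  have e := h.formula (Set.mem_insert _ _)
  simp only [bodyX, bodyY, stepOr, reduceCtorEq, MuFormula.and.injEq, false_or, or_false] at e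
  rcases h with ⟨K, hK, h⟩ | ⟨K, hK, h⟩ <;> rcases e with ⟨rfl, rfl⟩ | ⟨rfl, rfl⟩
  · have hD := (h _ (Set.mem_insert _ _)).resolve_left (by simp [bodyY])
    refine .inr (.inl ⟨K, hK, ?_⟩)
    rintro f (rfl | hf)
    · exact .inr ⟨by simp [stepOr], hD.2⟩
    · exact h f (Set.mem_insert_of_mem _ hf)
  · refine .inl (.inl ⟨K, hK, ?_⟩)
    rintro f (rfl | hf)
    · exact .inl (by simp)
    · exact h f (Set.mem_insert_of_mem _ hf)
  · refine .inl (.inr ⟨K, hK, ?_⟩)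
    rintro f (rfl | hf)
    · exact .inl (by simp)
    · exact h f (Set.mem_insert_of_mem _ hf)
  · have hD := (h _ (Set.mem_insert _ _)).resolve_left (by simp [bodyX])
    refine .inr (.inr ⟨K, hK, ?_⟩)
    rintro f (rfl | hf)
    · exact .inr ⟨by simp [stepOr], hD.2⟩
    · exact h f (Set.mem_insert_of_mem _ hf)

/-- Literals and bodies cannot occur in the conclusion of a modal rule, so every remaining name lies
in `K`. All rules are then dead, and only the condition on formulas in `FixpointInv` has content. -/
theorem BodyInvs.box {Γ : AnnSequent P V N} {φ : MuFormula P V} {a : List N}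
    (h : BodyInvs p x y H (insert (.box φ, a) Γ.dia)) :
    FixpointInv nameVar p x y H (insert (φ, a) Γ) := by
  have hφ : φ = nuXPhi p x y := by
    simpa [bodyX, bodyY, stepOr] using h.formula (Set.mem_insert _ _)
  subst hφ
  have hΓ : ∀ f ∈ Γ, f.1 = nuYPsi p x y := fun f hf => by
    simpa [bodyX, bodyY, stepOr] using
      h.formula (Set.mem_insert_of_mem _ (Set.mem_image_of_mem _ hf))
  have hK : ∃ K : Set N, (∀ n T, H n T → ¬ T ⊆ K) ∧
      AnnSequent.names (insert (nuXPhi p x y, a) Γ) ⊆ K := by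
    rcases h with ⟨K, hK, h⟩ | ⟨K, hK, h⟩
    all_goals
      refine ⟨K, hK, ?_⟩
      rintro n ⟨f, rfl | hf, hn⟩
      · exact ((h _ (Set.mem_insert _ _)).resolve_left (by simp [bodyX, bodyY])).2 n hn
      · exact ((h _ (Set.mem_insert_of_mem _ (Set.mem_image_of_mem _ hf))).resolve_left
          (by simp [bodyX, bodyY])).2 n hn
  obtain ⟨K, hK, hn⟩ := hK
  refine ⟨?_, fun n T hT hTS => absurd (hTS.trans hn) (hK n T hT),
    fun n T _ _ hT _ hTS => absurd (hTS.trans hn) (hK n T hT)⟩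
  rintro f (rfl | hf)
  · simp
  · simp [hΓ f hf]

/-- Each of the two alternatives admits literals of one polarity only. -/
theorem BodyInvs.false_of_axLit {q : P}
    (h : BodyInvs p x y H {((MuFormula.lit q : MuFormula P V), ([] : List N)), (.nlit q, [])}) :
    False := by
  rcases h with ⟨K, -, h⟩ | ⟨K, -, h⟩
  · simpa [bodyX, bodyY, stepOr] using h (.nlit q, []) (by simp)
  · simpa [bodyX, bodyY, stepOr] using h (.lit q, []) (by simp)

/-! ### Climbing the branch -/

namespace CloDerivation

variable [DecidableEq V] {Φ : Set (MuFormula P V)}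

/-- Every node that satisfies one of the invariants has a child that does. -/
theorem exists_child_inv (hxy : x ≠ y) (ρ : CloDerivation nameVar Φ) {u : List ℕ}
    {r : CloRule P V N} (hu : ρ.label u = some r)
    (h : FixpointInv nameVar p x y (ρ.Opened u) (r.conclusion nameVar) ∨
      BodyInvs p x y (ρ.Opened u) (r.conclusion nameVar)) :
    ∃ i r', ρ.label (u ++ [i]) = some r' ∧
      (FixpointInv nameVar p x y (ρ.Opened (u ++ [i])) (r'.conclusion nameVar) ∨
        BodyInvs p x y (ρ.Opened (u ++ [i])) (r'.conclusion nameVar)) := by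
  have hself : ∀ m T, ρ.Opened u m T → m ∈ T := by
    rintro m T ⟨v, Γ, φ, a, -, -, -, rfl⟩
    exact Set.mem_insert _ _
  have key : ∀ (i : ℕ) (S : AnnSequent P V N), (r.premises nameVar)[i]? = some S →
      (FixpointInv nameVar p x y (ρ.Opened (u ++ [i])) S ∨
        BodyInvs p x y (ρ.Opened (u ++ [i])) S) →
      ∃ i r', ρ.label (u ++ [i]) = some r' ∧
        (FixpointInv nameVar p x y (ρ.Opened (u ++ [i])) (r'.conclusion nameVar) ∨
          BodyInvs p x y (ρ.Opened (u ++ [i])) (r'.conclusion nameVar)) := by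
    intro i S hS hI
    obtain ⟨r', hr', rfl⟩ := ρ.exists_child hu hS
    exact ⟨i, r', hr', hI⟩
  have same (hr : ∀ Γ n φ a, r ≠ .clo Γ n φ a) (i : ℕ) : ρ.Opened (u ++ [i]) = ρ.Opened u := by
    funext n T
    rw [ρ.opened_concat, hu]
    simp [hr]
  have side := ρ.side u r hu
  cases r with
  | axLit q =>
    rcases h with h | h
    · have := h.formula (.lit q, []) (by simp [CloRule.conclusion])
      simp [nuXPhi, nuYPsi] at this
    · exact h.false_of_axLit.elim
  | or Γ φ ψ a =>
    refine key 0 _ rfl ?_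
    rw [same (by simp)]
    rcases h with h | h
    · have := h.formula _ (Set.mem_insert _ _)
      simp [nuXPhi, nuYPsi] at this
    · exact .inr h.or
  | and Γ φ ψ a =>
    rcases h with h | h
    · have := h.formula _ (Set.mem_insert _ _)
      simp [nuXPhi, nuYPsi] at this
    · rcases h.and with h | h
      · refine key 0 _ rfl ?_
        rw [same (by simp)]
        exact .inr h
      · refine key 1 _ rfl ?_
        rw [same (by simp)]
        exact .inr h
  | weak Γ φ a =>
    refine key 0 _ rfl ?_
    rw [same (by simp)]
    have hS : ∀ f ∈ Γ, f ∈ insert (φ, a) Γ := fun f => Set.mem_insert_of_mem _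
    exact h.imp (fun h => h.of_le (fun f hf => h.formula f (hS f hf))
      fun f hf => ⟨f, hS f hf, fun _ h => h, .inl rfl⟩)
      fun h => h.of_le fun f hf => ⟨f, hS f hf, fun _ h => h, rfl⟩
  | box Γ φ a =>
    refine key 0 _ rfl ?_
    rw [same (by simp)]
    rcases h with h | h
    · exact .inr (h.box hself)
    · exact .inl h.box
  | mu Γ z φ a =>
    rcases h with h | h
    · have := h.formula _ (Set.mem_insert _ _)
      simp [nuXPhi, nuYPsi] at this
    · have := h.formula (Set.mem_insert _ _)
      simp [bodyX, bodyY, stepOr] at this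
  | nu Γ z φ a =>
    refine key 0 _ rfl ?_
    rw [same (by simp)]
    rcases h with h | h
    · refine .inl (h.of_le ?_ ?_)
      · rintro f (rfl | hf)
        · rcases h.formula _ (Set.mem_insert _ _) with e | e | e | e
          · simp [(unfoldNu_of_nu_eq_nuXPhi hxy e).2]
          · simp [(unfoldNu_of_nu_eq_nuYPsi hxy e).2]
          · simp at e
          · simp at e
        · exact h.formula f (Set.mem_insert_of_mem _ hf)
      · rintro f (rfl | hf)
        · exact ⟨_, Set.mem_insert _ _, fun _ h => h, .inr ⟨z, φ, rfl⟩⟩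
        · exact ⟨f, Set.mem_insert_of_mem _ hf, fun _ h => h, .inl rfl⟩
    · have := h.formula (Set.mem_insert _ _)
      simp [bodyX, bodyY, stepOr] at this
  | exp l =>
    refine key 0 _ rfl ?_
    rw [same (by simp)]
    have hS : ∀ t ∈ l, (t.1, t.2.2) ∈ (CloRule.exp l).conclusion nameVar :=
      fun t ht => ⟨t, ht, rfl⟩
    refine h.imp (fun h => h.of_le ?_ ?_) fun h => h.of_le ?_
    all_goals rintro f ⟨t, ht, rfl⟩
    · exact h.formula (t.1, t.2.2) (hS t ht)
    · exact ⟨_, hS t ht, (side t ht).subset, .inl rfl⟩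
    · exact ⟨_, hS t ht, (side t ht).subset, rfl⟩
  | clo Γ n φ a =>
    refine key 0 _ rfl ?_
    rcases h with h | h
    -- Freshness of `n` comes from uniqueness of tokens: any earlier occurrence would need another
    -- discharge rule with token `n` closer to the root.
    · have hnew : ∀ m T, ρ.Opened u m T → n ∉ T := fun m T hT hn =>
        (ρ.opened_of_mem hT hn).elim (ρ.not_opened_of_clo hu)
      have hna := fun hn => (ρ.opened_of_mem_names hu (m := n) hn).elim (ρ.not_opened_of_clo hu)
      have hH : ∀ m T, ρ.Opened (u ++ [0]) m T ↔
          ρ.Opened u m T ∨ (m = n ∧ T = insert n Γ.names) := by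
        intro m T
        rw [ρ.opened_concat, hu]
        refine or_congr_right ⟨?_, ?_⟩
        · rintro ⟨Γ', φ', a', e, rfl⟩
          obtain ⟨rfl, rfl, rfl, rfl⟩ := CloRule.clo.inj (Option.some_inj.1 e)
          exact ⟨rfl, rfl⟩
        · rintro ⟨rfl, rfl⟩
          exact ⟨Γ, φ, a, rfl, rfl⟩
      simp only [CloRule.conclusion] at h hna
      rcases h.formula _ (Set.mem_insert _ _) with e | e | e | e
      · simp only at e
        obtain ⟨hn, hφ⟩ := unfoldNu_of_nu_eq_nuXPhi hxy e
        rw [e] at h hna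
        rw [hφ]
        exact .inl (h.clo_nuXPhi hxy hn hnew hself hna hH)
      · simp only at e
        obtain ⟨hn, hφ⟩ := unfoldNu_of_nu_eq_nuYPsi hxy e
        rw [e] at h hna
        rw [hφ]
        exact .inl (h.clo_nuYPsi hxy hn hnew hself hna hH)
      · simp at e
      · simp at e
    · have := h.formula (Set.mem_insert _ _)
      simp [bodyX, bodyY, stepOr] at this
  | asm S n =>
    obtain ⟨v, hv, Γ, φ, a, hl, rfl⟩ := ρ.discharged u S n hu
    rcases h with h | h
    · have hO : ρ.Opened u n (insert n Γ.names) :=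
        ⟨v, Γ, φ, a, hv, by rintro rfl; simp [hu] at hl, hl, rfl⟩
      have hn : n ∈ a ++ [n] := by simp
      have hT : insert n Γ.names ⊆
          AnnSequent.names (insert (.nu (nameVar n) φ, a ++ [n]) Γ) := by
        rintro m (rfl | ⟨f, hf, hm⟩)
        · exact ⟨_, Set.mem_insert _ _, hn⟩
        · exact ⟨f, Set.mem_insert_of_mem _ hf, hm⟩
      -- The companion is alive at its leaf, yet its token sits there on a folded `ν`-formula.
      rcases h.unfolded _ _ hO hT with h | h
      all_goals
        have := h.2 _ (Set.mem_insert _ _) hn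
        simp at this
    · have := h.formula (Set.mem_insert _ _)
      simp [bodyX, bodyY, stepOr] at this

end CloDerivation

end Invariants

theorem mainTheorem2 {P V N : Type*} [DecidableEq V] (nameVar : N → V)
    (hN : ∀ z : V, {n : N | nameVar n = z}.Infinite) (p : P) (x y : V) (hxy : x ≠ y) :
    ¬ ∃ ρ : CloDerivation nameVar (MuFormula.seqPhi p x y), ρ.IsProof := by

  rintro ⟨ρ, hρ⟩
  let I : Set (List ℕ) := {u | ∃ r, ρ.label u = some r ∧
    (FixpointInv nameVar p x y (ρ.Opened u) (r.conclusion nameVar) ∨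
      BodyInvs p x y (ρ.Opened u) (r.conclusion nameVar))}
  have hfin : I.Finite := hρ.subset fun u ⟨r, hr, _⟩ => by simp [hr]
  have hne : I.Nonempty := by
    have h := ρ.root
    obtain ⟨r, hr, hS⟩ := Option.map_eq_some_iff.1 h
    refine ⟨[], r, hr, .inl ?_⟩
    -- Nothing lies below the root, so the conditions on tokens hold vacuously.
    have hO : ∀ n T, ¬ ρ.Opened [] n T := by
      rintro n T ⟨v, Γ, φ, a, hv, hv', -⟩
      exact hv' (List.prefix_nil.1 hv)
    rw [hS]
    refine ⟨?_, fun n T hT => absurd hT (hO n T), fun n T _ _ hT => absurd hT (hO n T)⟩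
    rintro f ⟨φ, rfl | rfl, rfl⟩ <;> simp
  -- A deepest node satisfying an invariant would still have a child satisfying one.
  obtain ⟨u, ⟨r, hr, hI⟩, hmax⟩ := Set.exists_max_image I List.length hfin hne
  obtain ⟨i, r', hr', hI'⟩ := ρ.exists_child_inv hxy hr hI
  simpa using hmax (u ++ [i]) ⟨r', hr', hI'⟩
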